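/- A two-layer network consists of a source $S$, relays $1,\dots,t$, destinations $D_1,\dots,D_m$ and sets $\mathcal M_i\subseteq\{1,\dots,t\}$. Its directed edges are one from $S$ to each relay, and one from relay $r$ to $D_i$ whenever $r\in\mathcal M_i$. For $A\subseteq\{1,\dots,m\}$ let $M_A$ be the minimum number of edges in a cut separating $S$ from $\{D_i:i\in A\}$ (so $M_A=|\bigcup_{i\in A}\mathcal M_i|$). The source has independent messages $W_1,\dots,W_m$ and unlimited private randomness $\Theta$, independent of the messages. The other nodes have no randomness. A rate tuple $(R_1,\dots,R_m)$ is securely achievable against $k$ wiretapped edges if there are a finite field $\mathbb F_q$, a block length $n\ge 1$ and a code in which each edge $e$ carries a block $X_e\in\mathbb F_q^n$, which is a function of $(W_1,\dots,W_m,\Theta)$ if $e$ leaves $S$ and a function of the blocks entering the tail of $e$ otherwise, such that - $R_i=\frac1n H(W_i)$ for all $i$ (entropy in base $q$); - $H(W_i\mid X_e: e \text{ enters } D_i)=0$ for all $i$; - $I(W_1,\dots,W_m;(X_e)_{e\in Z})=0$ for every set $Z$ of at most $k$ edges. The secure capacity region is the closure of the set of securely achievable rate tuples. **Theorem.** Let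 $k\ge 0$. For every two-layer network with $m=3$ destinations such that $M_{\{i\}}\ge k$ for $i=1,2,3$, the secure capacity region is $$\Bigl\{(R_1,R_2,R_3)\in\mathbb R_{\ge 0}^3:\ \sum_{i\in A}R_i\le M_A-k\ \text{ for all nonempty } A\subseteq\{1,2,3\}\Bigr\}.$$ -/

import Mathlib

open MeasureTheory ProbabilityTheory InformationTheory Finset

/-! ## Shannon information measures of finitely valued random variables -/

/-- The Shannon entropy, in base `b`, of a random variable `X` with finitely many values. -/
noncomputable def entropy {Ω S : Type} [MeasurableSpace Ω] [Fintype S]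
    (b : ℝ) (μ : Measure Ω) (X : Ω → S) : ℝ :=
  (∑ x : S, Real.negMulLog (μ.real (X ⁻¹' {x}))) / Real.log b

/-- The conditional entropy `H(X | Y) = ∑ y, P(Y = y) * H(X | Y = y)`, in base `b`. -/
noncomputable def condEntropy {Ω S T : Type} [MeasurableSpace Ω] [Fintype S] [Fintype T]
    (b : ℝ) (μ : Measure Ω) (X : Ω → S) (Y : Ω → T) : ℝ :=
  ∑ y : T, μ.real (Y ⁻¹' {y}) * entropy b (μ[|Y ⁻¹' {y}]) X

/-- The mutual information `I(X ; Y)`: the Kullback-Leibler divergence of the joint law from the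
product of the marginal laws. -/
noncomputable def mutualInfo {Ω S T : Type} [MeasurableSpace Ω] [MeasurableSpace S]
    [MeasurableSpace T] (μ : Measure Ω) (X : Ω → S) (Y : Ω → T) : ENNReal :=
  klDiv (μ.map (fun ω => (X ω, Y ω))) ((μ.map X).prod (μ.map Y))

/-! ## Two-layer networks -/

/-- A two-layer network with `m` destinations: `t` relays, each joined to the source, and for each
destination `i` the set `conn i` of the relays that are joined to it. -/
structure TwoLayerNetwork (m : ℕ) where
  t : ℕ
  conn : Fin m → Finset (Fin t)

namespace TwoLayerNetwork

variable {m : ℕ}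

/-- The nodes: the source, the relays and the destinations. -/
inductive Node (N : TwoLayerNetwork m) : Type
  | source : Node N
  | relay (r : Fin N.t) : Node N
  | dest (i : Fin m) : Node N
  deriving DecidableEq

/-- The edges: one from the source to every relay `r`, and one from the relay `r` to the
destination `i` for every pair `(i, r)` with `r ∈ conn i`. -/
abbrev Edge (N : TwoLayerNetwork m) : Type :=
  Fin N.t ⊕ {p : Fin m × Fin N.t // p.2 ∈ N.conn p.1}

/-- The node that an edge leaves. -/
def tail (N : TwoLayerNetwork m) : N.Edge → N.Node
  | Sum.inl _ => Node.source
  | Sum.inr p => Node.relay p.1.2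

/-- The node that an edge enters. -/
def head (N : TwoLayerNetwork m) : N.Edge → N.Node
  | Sum.inl r => Node.relay r
  | Sum.inr p => Node.dest p.1.1

/-- The incoming edges of a node. -/
abbrev In (N : TwoLayerNetwork m) (v : N.Node) : Type := {e : N.Edge // N.head e = v}

/-- The capacity of the minimum cut between the source and the set of destinations `A`
(all edges have unit capacity): the least number of edges that leave a set of nodes which contains
the source and none of the destinations in `A`. -/
noncomputable def minCut (N : TwoLayerNetwork m) (A : Finset (Fin m)) : ℕ :=
  sInf {c : ℕ | ∃ U : Set N.Node, Node.source ∈ U ∧ (∀ i ∈ A, Node.dest i ∉ U) ∧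
    c = {e : N.Edge | N.tail e ∈ U ∧ N.head e ∉ U}.ncard}

/-- A code of block length `n` over the finite field `F`. The messages `W i` are independent, the
source also has the randomness `Θ`, independent of the messages and with values in any measurable
space. The symbol `X e`, sent over `n` uses of the edge `e`, is a function of all messages and of
`Θ` if `e` leaves the source, and otherwise a function of the symbols that enter the tail of `e`. -/
structure Code (N : TwoLayerNetwork m) (F : Type) [MeasurableSpace F] (n : ℕ) where
  Ω : Type
  [mΩ : MeasurableSpace Ω]
  μ : Measure Ω
  [prob : IsProbabilityMeasure μ]
  /-- the sizes of the message alphabets -/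
  c : Fin m → ℕ
  W : (i : Fin m) → Ω → Fin (c i)
  measurable_W : ∀ i, Measurable (W i)
  Rand : Type
  [mRand : MeasurableSpace Rand]
  Θ : Ω → Rand
  measurable_Θ : Measurable Θ
  indep_W : iIndepFun W μ
  indep_Θ : IndepFun (fun ω i => W i ω) Θ μ
  /-- the encoding functions of the source -/
  fSource : N.Edge → ((i : Fin m) → Fin (c i)) × Rand → (Fin n → F)
  measurable_fSource : ∀ e, Measurable (fSource e)
  /-- the encoding functions of the other nodes, which have no randomness -/
  fInner : (e : N.Edge) → (N.In (N.tail e) → (Fin n → F)) → (Fin n → F)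
  X : N.Edge → Ω → (Fin n → F)
  X_source : ∀ e, N.tail e = Node.source → ∀ ω, X e ω = fSource e (fun i => W i ω, Θ ω)
  X_inner : ∀ e, N.tail e ≠ Node.source → ∀ ω, X e ω = fInner e (fun l => X l.1 ω)

attribute [instance] Code.mΩ Code.prob Code.mRand

namespace Code

variable {N : TwoLayerNetwork m} {F : Type} [MeasurableSpace F] {n : ℕ}

/-- The rate of message `i`: entropy per channel use, in units of one symbol of `F`. -/
noncomputable def rate [Fintype F] (C : N.Code F n) (i : Fin m) : ℝ :=
  entropy (Fintype.card F : ℝ) C.μ (C.W i) / (n : ℝ)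

/-- Zero-error decoding: `H(W i | symbols that enter destination i) = 0` for all `i`. -/
def IsReliable [Fintype F] [DecidableEq F] (C : N.Code F n) : Prop :=
  ∀ i : Fin m, condEntropy (Fintype.card F : ℝ) C.μ (C.W i)
    (fun ω (l : N.In (Node.dest i)) => C.X l.1 ω) = 0

/-- Perfect secrecy against an eavesdropper on any (at most) `k` edges. -/
def IsSecure (C : N.Code F n) (k : ℕ) : Prop :=
  ∀ Z : Finset N.Edge, Z.card ≤ k →
    mutualInfo C.μ (fun ω i => C.W i ω) (fun ω (e : {e // e ∈ Z}) => C.X e.1 ω) = 0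

end Code

/-- A rate tuple is securely achievable if it is the rate tuple of a reliable and secure code of
some block length over some finite field. -/
def SecurelyAchievable (N : TwoLayerNetwork m) (k : ℕ) (R : Fin m → ℝ) : Prop :=
  ∃ (F : Type) (_ : Field F) (_ : Fintype F) (_ : DecidableEq F) (_ : MeasurableSpace F)
    (_ : DiscreteMeasurableSpace F) (n : ℕ) (_ : 0 < n) (C : N.Code F n),
    C.IsReliable ∧ C.IsSecure k ∧ ∀ i, R i = C.rate i

/-- The secure capacity region: the closure of the set of securely achievable rate tuples. -/
def secureCapacityRegion (N : TwoLayerNetwork m) (k : ℕ) : Set (Fin m → ℝ) :=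
  closure {R | N.SecurelyAchievable k R}

end TwoLayerNetwork

/-!
The theorem holds for every number `m` of destinations, and the argument is the same for all of
them. Write `T A` for the set of relays that serve some destination in `A`; the minimum cut is
`|T A|` (`minCut_eq_card_neighbors`).

*Outer bound* (`Code.prod_card_support_le`). Let the eavesdropper see `k` of the relays in `T A`,
and fix a value of their symbols that has positive probability. By secrecy each tuple of messages
for `A` is still possible, and by reliability it is a function of the symbols on the other
`|T A| - k` relays in `T A`. Hence the numbers of possible messages multiply to at most
`q ^ (n * (|T A| - k))`, and the entropy of a message is at most the logarithm of the number of its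
values. Only supports are counted; joint entropies are not needed.

*Inner bound* (`securelyAchievable_of_sum_le`). Let `r i` be integers with
`∑ i ∈ A, r i ≤ n * (|T A| - k)`. Take the vector `x` of all `t * n` symbols on the first layer
uniformly distributed, let the relays forward their symbols, and let the messages be `W = D x` for
a matrix `D` with `r i` rows for the destination `i`, which are supported on the relays joined to
it. Then every destination can decode. If `D` still has full row rank after the columns of any `k`
relays are deleted, then `W` is independent of the symbols on these relays. By Hall's theorem the
rate constraints say exactly that, after such a deletion, the rows can be matched to columns in
their supports (`exists_matching`), so that some maximal minor of the matrix with indeterminate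
entries is a nonzero polynomial; suitable integers in place of the indeterminates, reduced modulo
a large prime, keep all these minors nonzero (`exists_matrix_det_ne_zero`). As a code the scheme is
described from the source: its randomness is `x - s (D x)`, for a linear section `s` of `D`, which
is uniform on the kernel of `D` and independent of `W`.

Rounding the rates down to multiples of `1 / n` gives the whole region in the closure, and the
region is closed.
-/

/-! ### Entropy of finitely valued random variables -/

section Entropy

variable {Ω S T : Type} [MeasurableSpace Ω] [Fintype S] [Fintype T] {b : ℝ} {μ : Measure Ω}

lemma entropy_nonneg [IsProbabilityMeasure μ] (hb : 1 ≤ b) (X : Ω → S) : 0 ≤ entropy b μ X :=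
  div_nonneg (sum_nonneg fun _ _ => Real.negMulLog_nonneg measureReal_nonneg measureReal_le_one)
    (Real.log_nonneg hb)

/-- Entropy is at most the logarithm of the number of values taken with positive probability. -/
lemma entropy_le_log_card_support [MeasurableSpace S] [MeasurableSingletonClass S]
    [IsProbabilityMeasure μ] (hb : 1 ≤ b) {X : Ω → S} (hX : Measurable X) :
    entropy b μ X ≤ Real.log ({x | μ.real (X ⁻¹' {x}) ≠ 0} : Finset S).card / Real.log b := by
  refine div_le_div_of_nonneg_right ?_ (Real.log_nonneg hb)
  set p : S → ℝ := fun x => μ.real (X ⁻¹' {x}) with hp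
  set P : Finset S := {x | p x ≠ 0} with hP
  have hsum : ∑ x, p x = 1 := by
    have := sum_measureReal_preimage_singleton (μ := μ) (f := X) (univ : Finset S)
      (fun y _ => hX (measurableSet_singleton y))
    simpa [hp] using this
  have hsumP : ∑ x ∈ P, p x = 1 := by rw [hP, sum_filter_ne_zero, hsum]
  have hcard : (0 : ℝ) < P.card := by
    have : P.Nonempty := by
      by_contra h
      rw [not_nonempty_iff_eq_empty] at h
      simp [h] at hsumP
    exact_mod_cast this.card_pos
  have hterm : ∀ x ∈ P, Real.negMulLog (p x) ≤ p x * Real.log P.card + ((P.card : ℝ)⁻¹ - p x) := by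
    intro x hx
    have hx0 : 0 < p x := lt_of_le_of_ne measureReal_nonneg (Ne.symm (by simpa [hP] using hx))
    have h1 := mul_le_mul_of_nonneg_left
      (Real.one_sub_inv_le_log_of_pos (mul_pos hx0 hcard)) hx0.le
    rw [Real.log_mul hx0.ne' hcard.ne'] at h1
    have h2 : p x * (1 - (p x * P.card)⁻¹) = p x - (P.card : ℝ)⁻¹ := by
      field_simp
    rw [h2] at h1
    rw [Real.negMulLog]
    linarith
  have h0 : ∑ x, Real.negMulLog (p x) = ∑ x ∈ P, Real.negMulLog (p x) := by
    refine (sum_subset (subset_univ P) fun x _ hx => ?_).symm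
    have : p x = 0 := by simpa [hP] using hx
    simp [this]
  change ∑ x, Real.negMulLog (p x) ≤ _
  rw [h0]
  refine (sum_le_sum hterm).trans ?_
  rw [sum_add_distrib, ← sum_mul, sum_sub_distrib, hsumP, sum_const, nsmul_eq_mul,
    mul_inv_cancel₀ hcard.ne']
  simp

lemma eq_of_entropy_eq_zero [MeasurableSpace S] [MeasurableSingletonClass S]
    [IsProbabilityMeasure μ] (hb : 1 < b) {X : Ω → S} (hX : Measurable X)
    (h : entropy b μ X = 0) {x x' : S} (hx : μ.real (X ⁻¹' {x}) ≠ 0)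
    (hx' : μ.real (X ⁻¹' {x'}) ≠ 0) : x = x' := by
  by_contra hne
  have hs : ∑ x : S, Real.negMulLog (μ.real (X ⁻¹' {x})) = 0 := by
    rcases div_eq_zero_iff.1 h with h | h
    · exact h
    · exact absurd h (Real.log_pos hb).ne'
  rw [sum_eq_zero_iff_of_nonneg fun _ _ =>
    Real.negMulLog_nonneg measureReal_nonneg measureReal_le_one] at hs
  -- a value of positive probability has probability one
  have hone : ∀ y, μ.real (X ⁻¹' {y}) ≠ 0 → μ.real (X ⁻¹' {y}) = 1 := by
    intro y hy
    have := hs y (mem_univ y)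
    rw [Real.negMulLog, mul_eq_zero, neg_eq_zero, Real.log_eq_zero] at this
    have h0 : 0 ≤ μ.real (X ⁻¹' {y}) := measureReal_nonneg
    rcases this with h | h | h | h
    · exact absurd h hy
    · exact absurd h hy
    · exact h
    · linarith
  have hd : Disjoint (X ⁻¹' {x}) (X ⁻¹' {x'}) :=
    Disjoint.preimage _ (Set.disjoint_singleton.2 hne)
  have hu := measureReal_union (μ := μ) hd (hX (measurableSet_singleton x'))
  rw [hone x hx, hone x' hx'] at hu
  have := measureReal_le_one (μ := μ) (s := X ⁻¹' {x} ∪ X ⁻¹' {x'})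
  linarith

lemma eq_of_condEntropy_eq_zero [MeasurableSpace S] [MeasurableSingletonClass S]
    [MeasurableSpace T] [MeasurableSingletonClass T]
    [IsProbabilityMeasure μ] (hb : 1 < b) {X : Ω → S} (hX : Measurable X) {Y : Ω → T}
    (hY : Measurable Y) (h : condEntropy b μ X Y = 0) {x x' : S} {y : T}
    (hx : μ (Y ⁻¹' {y} ∩ X ⁻¹' {x}) ≠ 0) (hx' : μ (Y ⁻¹' {y} ∩ X ⁻¹' {x'}) ≠ 0) : x = x' := by
  have hYm : MeasurableSet (Y ⁻¹' {y}) := hY (measurableSet_singleton y)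
  have hy : μ (Y ⁻¹' {y}) ≠ 0 := fun h0 => hx (measure_mono_null Set.inter_subset_left h0)
  have hprob : ∀ z, μ (Y ⁻¹' {z}) ≠ 0 → IsProbabilityMeasure (μ[|Y ⁻¹' {z}]) := fun z hz =>
    cond_isProbabilityMeasure hz
  have hterm : ∀ z ∈ (univ : Finset T),
      0 ≤ μ.real (Y ⁻¹' {z}) * entropy b (μ[|Y ⁻¹' {z}]) X := by
    intro z _
    by_cases hz : μ (Y ⁻¹' {z}) = 0
    · simp [measureReal_def, hz]
    · have := hprob z hz
      exact mul_nonneg measureReal_nonneg (entropy_nonneg hb.le X)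
  have hz := (sum_eq_zero_iff_of_nonneg hterm).1 h y (mem_univ y)
  have hr : μ.real (Y ⁻¹' {y}) ≠ 0 := by
    rw [measureReal_def]
    exact ENNReal.toReal_ne_zero.2 ⟨hy, measure_ne_top _ _⟩
  have := hprob y hy
  have hne : ∀ w, μ (Y ⁻¹' {y} ∩ X ⁻¹' {w}) ≠ 0 → (μ[|Y ⁻¹' {y}]).real (X ⁻¹' {w}) ≠ 0 := by
    intro w hw
    rw [measureReal_def]
    exact ENNReal.toReal_ne_zero.2 ⟨(cond_pos_of_inter_ne_zero hYm hw).ne', measure_ne_top _ _⟩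
  exact eq_of_entropy_eq_zero hb hX ((mul_eq_zero.1 hz).resolve_left hr) (hne x hx) (hne x' hx')

lemma condEntropy_comp_self [MeasurableSpace T] [MeasurableSingletonClass T]
    [IsProbabilityMeasure μ] {Y : Ω → T} (hY : Measurable Y) (g : T → S) :
    condEntropy b μ (fun ω => g (Y ω)) Y = 0 := by
  refine sum_eq_zero fun y _ => ?_
  by_cases hy : μ (Y ⁻¹' {y}) = 0
  · simp [measureReal_def, hy]
  have hYm : MeasurableSet (Y ⁻¹' {y}) := hY (measurableSet_singleton y)
  have : IsProbabilityMeasure (μ[|Y ⁻¹' {y}]) := cond_isProbabilityMeasure hy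
  refine mul_eq_zero_of_right _ (div_eq_zero_iff.2 (Or.inl (sum_eq_zero fun x _ => ?_)))
  rw [measureReal_def, cond_apply hYm]
  by_cases hx : g y = x
  · have : Y ⁻¹' {y} ∩ (fun ω => g (Y ω)) ⁻¹' {x} = Y ⁻¹' {y} := by
      rw [Set.inter_eq_left]
      intro ω hω
      have : Y ω = y := hω
      simp [this, hx]
    rw [this, ENNReal.inv_mul_cancel hy (measure_ne_top _ _)]
    simp
  · have : Y ⁻¹' {y} ∩ (fun ω => g (Y ω)) ⁻¹' {x} = ∅ := by
      ext ω
      simp only [Set.mem_inter_iff, Set.mem_preimage, Set.mem_singleton_iff,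
        Set.mem_empty_iff_false, iff_false, not_and]
      rintro rfl
      exact hx
    simp [this]

lemma mutualInfo_eq_zero_iff {S T : Type} [MeasurableSpace S] [MeasurableSpace T]
    [IsProbabilityMeasure μ] {X : Ω → S} {Y : Ω → T} (hX : Measurable X) (hY : Measurable Y) :
    mutualInfo μ X Y = 0 ↔ IndepFun X Y μ := by
  have := Measure.isProbabilityMeasure_map (μ := μ) hX.aemeasurable
  have := Measure.isProbabilityMeasure_map (μ := μ) hY.aemeasurable
  have := Measure.isProbabilityMeasure_map (μ := μ) (hX.prodMk hY).aemeasurable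
  rw [mutualInfo, klDiv_eq_zero_iff,
    indepFun_iff_map_prod_eq_prod_map_map hX.aemeasurable hY.aemeasurable]

end Entropy

/-! ### Homomorphisms on a uniformly distributed element of a finite group -/

section Uniform

variable {G : Type} [AddCommGroup G] [Fintype G] [MeasurableSpace G] [DiscreteMeasurableSpace G]

/-- A surjective homomorphism maps the uniform distribution to the uniform distribution. -/
lemma uniformOn_univ_preimage_singleton {A : Type} [AddCommGroup A] [Fintype A] {f : G →+ A}
    (hf : Function.Surjective f) (a : A) :
    uniformOn (Set.univ : Set G) (f ⁻¹' {a}) = (Fintype.card A : ENNReal)⁻¹ := by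
  classical
  have hfib : ∀ a' : A, #{g | f g = a'} = #{g | f g = a} := fun a' =>
    AddMonoidHom.card_fiber_eq_of_mem_range f (hf a') (hf a)
  have hcard : Fintype.card G = Fintype.card A * #{g | f g = a} := by
    rw [← card_univ, card_eq_sum_card_fiberwise (t := univ) (f := f) (fun _ _ => mem_univ _)]
    simp [hfib]
  have hset : f ⁻¹' {a} = (({g | f g = a} : Finset G) : Set G) := by ext; simp
  rw [uniformOn_univ, hset, Measure.count_apply_finset, hcard]
  have h1 : #{g | f g = a} ≠ 0 := by
    obtain ⟨g, hg⟩ := hf a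
    exact (card_pos.2 ⟨g, by simpa using hg⟩).ne'
  have h2 : (Fintype.card A : ENNReal) ≠ 0 := by simp
  rw [Nat.cast_mul, ENNReal.div_eq_inv_mul, ENNReal.mul_inv (by simp) (by simp), mul_assoc,
    ENNReal.inv_mul_cancel (by exact_mod_cast h1) (by simp), mul_one]

instance : IsProbabilityMeasure (uniformOn (Set.univ : Set G)) :=
  isProbabilityMeasure_uniformOn Set.finite_univ Set.univ_nonempty

/-- The joint law of `f` and `g` is uniform on `A × B`, hence the product of its marginals. -/
lemma indepFun_uniformOn_univ {A B : Type} [AddCommGroup A] [AddCommGroup B] [Fintype A] [Fintype B]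
    [MeasurableSpace A] [MeasurableSpace B] [DiscreteMeasurableSpace A] [DiscreteMeasurableSpace B]
    (f : G →+ A) (g : G →+ B) (hfg : ∀ a b, ∃ x, f x = a ∧ g x = b) :
    IndepFun f g (uniformOn (Set.univ : Set G)) := by
  have hf : Function.Surjective f := fun a => (hfg a 0).imp fun _ h => h.1
  have hg : Function.Surjective g := fun b => (hfg 0 b).imp fun _ h => h.2
  have hp : Function.Surjective (f.prod g) := fun ⟨a, b⟩ =>
    (hfg a b).imp fun _ h => Prod.ext h.1 h.2
  have hfm : Measurable f := Measurable.of_discrete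
  have hgm : Measurable g := Measurable.of_discrete
  rw [indepFun_iff_map_prod_eq_prod_map_map hfm.aemeasurable hgm.aemeasurable]
  refine Measure.ext_of_singleton fun ⟨a, b⟩ => ?_
  have h := uniformOn_univ_preimage_singleton hp (a, b)
  rw [Measure.map_apply (hfm.prodMk hgm) (measurableSet_singleton _),
    ← Set.singleton_prod_singleton, Measure.prod_prod,
    Measure.map_apply hfm (measurableSet_singleton _),
    Measure.map_apply hgm (measurableSet_singleton _), uniformOn_univ_preimage_singleton hf,
    uniformOn_univ_preimage_singleton hg, Set.singleton_prod_singleton]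
  refine h.trans ?_
  rw [Fintype.card_prod, Nat.cast_mul, ENNReal.mul_inv (by simp) (by simp)]

/-- The joint law of the `f i` is uniform on `∀ i, A i`, hence the product of its marginals. -/
lemma iIndepFun_uniformOn_univ {ι : Type} [Fintype ι] {A : ι → Type} [∀ i, AddCommGroup (A i)]
    [∀ i, Fintype (A i)] [∀ i, MeasurableSpace (A i)] [∀ i, DiscreteMeasurableSpace (A i)]
    (f : ∀ i, G →+ A i) (hf : ∀ a : ∀ i, A i, ∃ x, ∀ i, f i x = a i) :
    iIndepFun (fun i => f i) (uniformOn (Set.univ : Set G)) := by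
  classical
  have hfi : ∀ i, Function.Surjective (f i) := fun i a => by
    obtain ⟨x, hx⟩ := hf (Pi.single i a)
    exact ⟨x, by simpa using hx i⟩
  have hp : Function.Surjective (AddMonoidHom.mk' (fun x i => f i x) (by
      intro x y; ext i; simp) : G →+ ∀ i, A i) := fun a => (hf a).imp fun _ h => funext h
  have hfm : ∀ i, Measurable (f i) := fun i => Measurable.of_discrete
  rw [iIndepFun_iff_map_fun_eq_pi_map fun i => (hfm i).aemeasurable]
  have := fun i => Measure.isProbabilityMeasure_map (μ := uniformOn (Set.univ : Set G))
    (hfm i).aemeasurable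
  refine Measure.ext_of_singleton fun a => ?_
  have h := uniformOn_univ_preimage_singleton hp a
  rw [Measure.map_apply (measurable_pi_lambda _ hfm) (measurableSet_singleton _),
    Measure.pi_singleton]
  refine h.trans ?_
  have hmap : ∀ i, (uniformOn (Set.univ : Set G)).map (f i) {a i} =
      (Fintype.card (A i) : ENNReal)⁻¹ := fun i => by
    rw [Measure.map_apply (hfm i) (measurableSet_singleton _),
      uniformOn_univ_preimage_singleton (hfi i)]
  rw [prod_congr rfl fun i _ => hmap i, Fintype.card_pi, Nat.cast_prod,
    ENNReal.prod_inv_distrib]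
  intro i _ j _ _
  exact Or.inl (by simp)

lemma entropy_uniformOn_univ {A S : Type} [AddCommGroup A] [Fintype A] [Fintype S] (b : ℝ)
    {f : G →+ A} (hf : Function.Surjective f) (e : A ≃ S) :
    entropy b (uniformOn (Set.univ : Set G)) (fun x => e (f x)) =
      Real.log (Fintype.card A) / Real.log b := by
  have h : ∀ s, (uniformOn (Set.univ : Set G)).real ((fun x => e (f x)) ⁻¹' {s}) =
      (Fintype.card A : ℝ)⁻¹ := by
    intro s
    have : (fun x => e (f x)) ⁻¹' {s} = f ⁻¹' {e.symm s} := by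
      ext x
      simp [Equiv.eq_symm_apply]
    rw [this, measureReal_def, uniformOn_univ_preimage_singleton hf]
    simp
  have h0 : (Fintype.card A : ℝ) ≠ 0 := by simp
  rw [entropy, sum_congr rfl fun s _ => by rw [h s], sum_const, card_univ, nsmul_eq_mul,
    ← Fintype.card_congr e, Real.negMulLog, Real.log_inv]
  congr 1
  field_simp

end Uniform

namespace TwoLayerNetwork

variable {m : ℕ}

/-! ### Minimum cuts -/

/-- The relays joined to at least one destination in `A`. -/
def neighbors (N : TwoLayerNetwork m) (A : Finset (Fin m)) : Finset (Fin N.t) := A.biUnion N.conn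

lemma neighbors_mono (N : TwoLayerNetwork m) {A B : Finset (Fin m)} (h : A ⊆ B) :
    N.neighbors A ⊆ N.neighbors B := biUnion_subset_biUnion_of_subset_left _ h

lemma minCut_eq_card_neighbors (N : TwoLayerNetwork m) (A : Finset (Fin m)) :
    N.minCut A = (N.neighbors A).card := by
  classical
  refine IsLeast.csInf_eq ⟨?_, ?_⟩
  · -- the relays that serve `A` are cut off together with `A`
    refine ⟨{v | v = Node.source ∨ (∃ r ∉ N.neighbors A, v = Node.relay r) ∨
      ∃ i ∉ A, v = Node.dest i}, Or.inl rfl, by simp, ?_⟩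
    rw [← card_map ⟨(Sum.inl : _ → N.Edge), Sum.inl_injective⟩, ← Set.ncard_coe_finset]
    congr 1
    ext e
    rcases e with r | ⟨⟨i, r⟩, hr⟩
    · simp only [coe_map, Function.Embedding.coeFn_mk, Set.mem_image, mem_coe, Sum.inl.injEq,
        exists_eq_right, tail, head, Set.mem_ofPred_eq, reduceCtorEq, and_false,
        exists_false, or_false, false_or, Node.relay.injEq, true_and, not_exists, not_and]
      exact ⟨fun h x hx e => hx (e ▸ h), fun h => by_contra fun hr => h r hr rfl⟩
    · simp only [neighbors, coe_map, Function.Embedding.coeFn_mk, Set.mem_image, mem_coe,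
        reduceCtorEq, and_false, exists_false, tail, head, Set.mem_ofPred_eq, Node.relay.injEq,
        Node.dest.injEq, exists_eq_right', false_or, or_false, not_not, false_iff, not_and]
      intro h hi
      exact h (mem_biUnion.2 ⟨i, hi, hr⟩)
  · -- each relay that serves `A` touches an edge of the cut, and no edge touches two relays
    rintro c ⟨U, hs, hA, rfl⟩
    have hex : ∀ r ∈ N.neighbors A, ∃ i ∈ A, r ∈ N.conn i := fun r hr => mem_biUnion.1 hr
    choose i hi hr using hex
    rw [← Set.ncard_coe_finset]
    refine Set.ncard_le_ncard_of_injOn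
      (fun r => if h : Node.relay r ∈ U ∧ r ∈ N.neighbors A
        then Sum.inr ⟨(i r h.2, r), hr r h.2⟩ else Sum.inl r) ?_ ?_ (Set.toFinite _)
    · intro r hrA
      by_cases h : Node.relay r ∈ U
      · have hrA' : r ∈ N.neighbors A := hrA
        simp [h, hrA', tail, head, hA _ (hi r hrA')]
      · simp [h, tail, head, hs]
    · intro r _ r' _ h
      dsimp only at h
      split_ifs at h <;> simp_all

namespace Code

variable {N : TwoLayerNetwork m} {F : Type} [MeasurableSpace F] {n : ℕ}

/-- The symbols that a destination receives are determined by those that the source sends to the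
relays joined to it. -/
lemma X_inr_congr (C : N.Code F n) {ω ω' : C.Ω} (p : {p : Fin m × Fin N.t // p.2 ∈ N.conn p.1})
    (h : C.X (Sum.inl p.1.2) ω = C.X (Sum.inl p.1.2) ω') :
    C.X (Sum.inr p) ω = C.X (Sum.inr p) ω' := by
  have ht : N.tail (Sum.inr p) ≠ Node.source := by simp [tail]
  rw [C.X_inner _ ht, C.X_inner _ ht]
  congr 1
  funext ⟨e, he⟩
  rcases e with r | q
  · have : r = p.1.2 := by simpa [tail, head] using he
    subst this
    exact h
  · simp [tail, head] at he

lemma measurable_X [Finite F] [DiscreteMeasurableSpace F] (C : N.Code F n) (e : N.Edge) :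
    Measurable (C.X e) := by
  have hs : ∀ e, N.tail e = Node.source → Measurable (C.X e) := by
    intro e he
    have : C.X e = fun ω => C.fSource e (fun i => C.W i ω, C.Θ ω) := funext (C.X_source e he)
    rw [this]
    exact (C.measurable_fSource e).comp
      ((measurable_pi_lambda _ C.measurable_W).prodMk C.measurable_Θ)
  rcases e with r | p
  · exact hs _ rfl
  · have ht : N.tail (Sum.inr p) ≠ Node.source := by simp [tail]
    have : C.X (Sum.inr p) = C.fInner (Sum.inr p) ∘
        fun ω (l : N.In (N.tail (Sum.inr p))) => C.X l.1 ω := funext (C.X_inner _ ht)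
    rw [this]
    refine Measurable.of_discrete.comp (measurable_pi_lambda _ fun ⟨e, he⟩ => ?_)
    rcases e with r | q
    · exact hs _ rfl
    · simp [tail, head] at he

/-! ### The outer bound -/

/-- The values that the message `i` takes with positive probability. -/
noncomputable def support (C : N.Code F n) (i : Fin m) : Finset (Fin (C.c i)) :=
  {w | C.μ.real (C.W i ⁻¹' {w}) ≠ 0}

lemma mem_support {C : N.Code F n} {i : Fin m} {w : Fin (C.c i)} :
    w ∈ C.support i ↔ C.μ.real (C.W i ⁻¹' {w}) ≠ 0 := by simp [support]

/-- The symbols that enter the destination `i`. -/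
def received (C : N.Code F n) (i : Fin m) : C.Ω → N.In (Node.dest i) → Fin n → F :=
  fun ω l => C.X l.1 ω

/-- In a reliable code, the received symbols determine the message almost surely. -/
lemma IsReliable.eq_of_joint_pos [Fintype F] [DecidableEq F] [DiscreteMeasurableSpace F]
    (hF : 1 < Fintype.card F) {C : N.Code F n} (hrel : C.IsReliable) {i : Fin m}
    {y : N.In (Node.dest i) → Fin n → F} {w w' : Fin (C.c i)}
    (h : C.μ (C.received i ⁻¹' {y} ∩ C.W i ⁻¹' {w}) ≠ 0)
    (h' : C.μ (C.received i ⁻¹' {y} ∩ C.W i ⁻¹' {w'}) ≠ 0) : w = w' := by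
  have hY : Measurable (C.received i) := measurable_pi_lambda _ fun l => C.measurable_X l.1
  have hq : (1 : ℝ) < Fintype.card F := by exact_mod_cast hF
  exact eq_of_condEntropy_eq_zero hq (C.measurable_W i) hY (hrel i) h h'

/-- Almost surely, the received symbols and the message have positive joint probability. -/
lemma ae_joint_pos [Finite F] (C : N.Code F n) (i : Fin m) :
    ∀ᵐ ω ∂C.μ, C.μ (C.received i ⁻¹' {C.received i ω} ∩ C.W i ⁻¹' {C.W i ω}) ≠ 0 := by
  have h : ∀ᵐ ω ∂C.μ, ∀ q : (N.In (Node.dest i) → Fin n → F) × Fin (C.c i),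
      C.μ (C.received i ⁻¹' {q.1} ∩ C.W i ⁻¹' {q.2}) = 0 →
        ω ∉ C.received i ⁻¹' {q.1} ∩ C.W i ⁻¹' {q.2} := by
    rw [ae_all_iff]
    intro q
    by_cases hq : C.μ (C.received i ⁻¹' {q.1} ∩ C.W i ⁻¹' {q.2}) = 0
    · filter_upwards [measure_eq_zero_iff_ae_notMem.1 hq] with ω hω _ using hω
    · exact Filter.Eventually.of_forall fun ω h => absurd h hq
  filter_upwards [h] with ω hω h0
  exact hω (C.received i ω, C.W i ω) h0 ⟨rfl, rfl⟩

/-- Fix a value that the eavesdropped set `S` of relays sees with positive probability. Every tuple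
of messages for the destinations in `A` still occurs, by secrecy, and it is determined, by
reliability, by the symbols on the other relays that serve `A`; so there are at most as many
tuples as values of these symbols. -/
lemma prod_card_support_le [Fintype F] [DecidableEq F] [DiscreteMeasurableSpace F]
    (hF : 1 < Fintype.card F) (C : N.Code F n) {k : ℕ} (hrel : C.IsReliable) (hsec : C.IsSecure k)
    (A : Finset (Fin m)) {S : Finset (Fin N.t)} (hS : S ⊆ N.neighbors A) (hk : S.card ≤ k) :
    ∏ i ∈ A, (C.support i).card ≤ Fintype.card F ^ (n * ((N.neighbors A).card - S.card)) := by
  classical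
  set Z : Finset N.Edge := S.map ⟨Sum.inl, Sum.inl_injective⟩ with hZ
  set XZ : C.Ω → {e // e ∈ Z} → Fin n → F := fun ω e => C.X e.1 ω with hXZ
  have hXZm : Measurable XZ := measurable_pi_lambda _ fun e => C.measurable_X e.1
  have hWm : Measurable fun ω i => C.W i ω := measurable_pi_lambda _ C.measurable_W
  have hind : IndepFun (fun ω i => C.W i ω) XZ C.μ :=
    (mutualInfo_eq_zero_iff hWm hXZm).1 (hsec Z (by rwa [hZ, card_map]))
  obtain ⟨z, hz⟩ : ∃ z, C.μ (XZ ⁻¹' {z}) ≠ 0 := by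
    by_contra! h
    have hu : C.μ (⋃ z, XZ ⁻¹' {z}) = 0 := measure_iUnion_null h
    have : (⋃ z, XZ ⁻¹' {z}) = Set.univ := by ext; simp
    rw [this, measure_univ] at hu
    exact one_ne_zero hu
  have hgood : ∀ᵐ ω ∂C.μ, ∀ i, C.μ (C.received i ⁻¹' {C.received i ω} ∩
      C.W i ⁻¹' {C.W i ω}) ≠ 0 := ae_all_iff.2 C.ae_joint_pos
  have hex : ∀ w : ∀ i : A, C.support i, ∃ ω, (∀ i : A, C.W i ω = w i) ∧ XZ ω = z ∧
      ∀ i, C.μ (C.received i ⁻¹' {C.received i ω} ∩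
      C.W i ⁻¹' {C.W i ω}) ≠ 0 := by
    intro w
    set s : (i : Fin m) → Set (Fin (C.c i)) :=
      fun i => if h : i ∈ A then {(w ⟨i, h⟩).1} else Set.univ with hs
    have hpos : C.μ (⋂ i ∈ univ, C.W i ⁻¹' s i) ≠ 0 := by
      rw [C.indep_W.measure_inter_preimage_eq_mul univ fun i _ => MeasurableSet.of_discrete]
      refine prod_ne_zero_iff.2 fun i _ => ?_
      by_cases h : i ∈ A
      · have := mem_support.1 (w ⟨i, h⟩).2
        simp only [hs, h, dite_true]
        exact fun h0 => this (by rw [measureReal_def, h0]; rfl)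
      · simp [hs, h]
    have hpos' : C.μ ((fun ω i => C.W i ω) ⁻¹' Set.univ.pi s ∩ XZ ⁻¹' {z}) ≠ 0 := by
      rw [hind.measure_inter_preimage_eq_mul _ _ MeasurableSet.of_discrete
        (measurableSet_singleton z)]
      refine mul_ne_zero ?_ hz
      convert hpos using 2
      ext ω
      simp
    obtain ⟨ω, ⟨h1, h2⟩, h3⟩ := ((frequently_ae_mem_iff.2 hpos').and_eventually hgood).exists
    refine ⟨ω, fun i => ?_, h2, h3⟩
    have := h1 i.1 (Set.mem_univ _)
    simpa [hs] using this
  choose ω hω1 hω2 hω3 using hex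
  have hinj : Function.Injective fun w (r : ((N.neighbors A) \ S : Finset _)) =>
      C.X (Sum.inl r.1) (ω w) := by
    intro w w' h
    have hX : ∀ r ∈ N.neighbors A, C.X (Sum.inl r) (ω w) = C.X (Sum.inl r) (ω w') := by
      intro r hr
      by_cases hrS : r ∈ S
      · have := (hω2 w).trans (hω2 w').symm
        exact congr_fun this ⟨Sum.inl r, by simpa [hZ] using hrS⟩
      · exact congr_fun h ⟨r, mem_sdiff.2 ⟨hr, hrS⟩⟩
    funext i
    have hY : C.received i.1 (ω w) = C.received i.1 (ω w') := by
      funext ⟨e, he⟩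
      rcases e with r | ⟨⟨j, r⟩, hr⟩
      · simp [head] at he
      · have hj : j = i.1 := by simpa [head] using he
        refine C.X_inr_congr _ (hX r (mem_biUnion.2 ⟨i.1, i.2, ?_⟩))
        rw [← hj]
        exact hr
    have h1 := hω3 w i.1
    have h2 := hω3 w' i.1
    rw [← hY] at h2
    have := hrel.eq_of_joint_pos hF h1 h2
    rw [hω1, hω1] at this
    exact Subtype.ext this
  have hle := Fintype.card_le_of_injective _ hinj
  simp only [Fintype.card_pi, Fintype.card_coe, prod_const, card_univ, Fintype.card_fin,
    card_sdiff_of_subset hS] at hle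
  rw [prod_coe_sort A fun i => (C.support i).card, ← pow_mul] at hle
  exact hle

lemma sum_rate_le [Fintype F] [DecidableEq F] [DiscreteMeasurableSpace F]
    (hF : 1 < Fintype.card F) (hn : 0 < n) (C : N.Code F n) {k : ℕ} (hrel : C.IsReliable)
    (hsec : C.IsSecure k) (A : Finset (Fin m)) (hk : k ≤ N.minCut A) :
    ∑ i ∈ A, C.rate i ≤ (N.minCut A : ℝ) - k := by
  have hq : (1 : ℝ) < Fintype.card F := by exact_mod_cast hF
  have hlog := Real.log_pos hq
  have hn' : (0 : ℝ) < n := by exact_mod_cast hn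
  rw [minCut_eq_card_neighbors] at hk ⊢
  obtain ⟨S, hS, rfl⟩ := exists_subset_card_eq hk
  have h := C.prod_card_support_le hF hrel hsec A hS le_rfl
  have hpos : ∀ i ∈ A, ((C.support i).card : ℝ) ≠ 0 := by
    intro i _ h0
    have h0' : C.support i = ∅ := by simpa using h0
    have hu := sum_measureReal_preimage_singleton (μ := C.μ) (f := C.W i) univ
      (fun y _ => C.measurable_W i (measurableSet_singleton y))
    have : ∀ w, C.μ.real (C.W i ⁻¹' {w}) = 0 := by
      intro w
      by_contra hw
      have : w ∈ C.support i := mem_support.2 hw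
      simp [h0'] at this
    simp [this] at hu
  have hR : ∏ i ∈ A, ((C.support i).card : ℝ) ≤
      (Fintype.card F : ℝ) ^ (n * ((N.neighbors A).card - S.card)) := by exact_mod_cast h
  have hlogle := Real.log_le_log (prod_pos fun i hi =>
    lt_of_le_of_ne (Nat.cast_nonneg _) (hpos i hi).symm) hR
  rw [Real.log_prod hpos, Real.log_pow, Nat.cast_mul, Nat.cast_sub hk] at hlogle
  calc ∑ i ∈ A, C.rate i
      ≤ ∑ i ∈ A, Real.log (C.support i).card / Real.log (Fintype.card F) / n :=
        sum_le_sum fun i _ => div_le_div_of_nonneg_right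
          (entropy_le_log_card_support hq.le (C.measurable_W i)) hn'.le
    _ = (∑ i ∈ A, Real.log (C.support i).card) / Real.log (Fintype.card F) / n := by
        rw [sum_div, sum_div]
    _ ≤ _ := by
        rw [div_le_iff₀ hn', div_le_iff₀ hlog]
        linarith

end Code

end TwoLayerNetwork

/-! ### Matrices with prescribed support and many nonzero maximal minors -/

/-- If for every set `S` in a finite family the rows can be matched to columns of their supports
outside `S`, then over some prime field there is a matrix with these supports that has, for every
`S` in the family, a nonzero maximal minor avoiding `S`. -/
lemma exists_matrix_det_ne_zero {ρ κ ι : Type} [Fintype ρ] [DecidableEq ρ] [DecidableEq κ]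
    [Fintype ι] (supp : ρ → Finset κ) (S : ι → Finset κ)
    (hS : ∀ a, ∃ f : ρ → κ, Function.Injective f ∧ ∀ i, f i ∈ supp i \ S a) :
    ∃ (p : ℕ) (_ : Fact p.Prime) (D : Matrix ρ κ (ZMod p)), (∀ i, ∀ c ∉ supp i, D i c = 0) ∧
      ∀ a, ∃ f : ρ → κ, (∀ i, f i ∉ S a) ∧ (D.submatrix id f).det ≠ 0 := by
  choose f hf hfS using hS
  let M : Matrix ρ κ (MvPolynomial (ρ × κ) ℤ) :=
    Matrix.of fun i c => if c ∈ supp i then MvPolynomial.X (i, c) else 0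
  have hM : ∀ a, (M.submatrix id (f a)).det ≠ 0 := by
    intro a h0
    -- the indicator of the matching specializes the minor to the identity matrix
    have h1 := congr_arg (MvPolynomial.eval fun q : ρ × κ => if q.2 = f a q.1 then (1 : ℤ) else 0) h0
    rw [RingHom.map_det, map_zero] at h1
    have : (MvPolynomial.eval fun q : ρ × κ => if q.2 = f a q.1 then (1 : ℤ) else 0).mapMatrix
        (M.submatrix id (f a)) = 1 := by
      ext i j
      by_cases hij : i = j
      · subst hij
        simp [M, (mem_sdiff.1 (hfS a i)).1]
      · have hne : f a j ≠ f a i := fun h => hij (hf a h).symm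
        by_cases hs : f a j ∈ supp i <;> simp [M, hs, hne, hij]
    rw [this, Matrix.det_one] at h1
    exact one_ne_zero h1
  have hprod : ∏ a, (M.submatrix id (f a)).det ≠ 0 := prod_ne_zero_iff.2 fun a _ => hM a
  obtain ⟨v, hv⟩ : ∃ v, MvPolynomial.eval v (∏ a, (M.submatrix id (f a)).det) ≠ 0 := by
    by_contra! h
    exact hprod (MvPolynomial.funext fun v => by rw [h v, map_zero])
  set d := MvPolynomial.eval v (∏ a, (M.submatrix id (f a)).det) with hd
  -- a prime larger than the product of the minors divides none of them
  obtain ⟨p, hpd, hp⟩ := Nat.exists_infinite_primes (d.natAbs + 1)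
  have hpd' : ¬ (p : ℤ) ∣ d := fun h => by
    have := Nat.le_of_dvd (Int.natAbs_pos.2 hv) (Int.natCast_dvd.1 h)
    omega
  let φ : MvPolynomial (ρ × κ) ℤ →+* ZMod p := (Int.castRingHom (ZMod p)).comp (MvPolynomial.eval v)
  refine ⟨p, ⟨hp⟩, M.map φ, ?_, fun a => ⟨f a, fun i => (mem_sdiff.1 (hfS a i)).2, ?_⟩⟩
  · intro i c hc
    simp [M, hc]
  · intro h0
    have h1 : φ (M.submatrix id (f a)).det = 0 := by
      rw [RingHom.map_det]
      exact h0
    refine hpd' (((ZMod.intCast_zmod_eq_zero_iff_dvd _ p).1 h1).trans ?_)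
    rw [hd, map_prod]
    exact dvd_prod_of_mem _ (mem_univ a)

/-- A matrix with a nonzero maximal minor outside `S` still maps onto everything when the
coordinates in `S` are prescribed. -/
lemma exists_mulVec_eq_of_det_ne_zero {ρ κ F : Type} [Fintype ρ] [DecidableEq ρ] [Fintype κ]
    [DecidableEq κ] [Field F] (D : Matrix ρ κ F) (S : Finset κ) {f : ρ → κ} (hfS : ∀ i, f i ∉ S)
    (hdet : (D.submatrix id f).det ≠ 0) (w : ρ → F) (y : κ → F) :
    ∃ x, D.mulVec x = w ∧ ∀ c ∈ S, x c = y c := by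
  -- correct `y` on the columns of the minor
  let v : ρ → F := (D.submatrix id f)⁻¹.mulVec (w - D.mulVec y)
  refine ⟨y + fun c => ∑ j, if f j = c then v j else 0, ?_, ?_⟩
  · have hv : (D.submatrix id f).mulVec v = w - D.mulVec y := by
      rw [Matrix.mulVec_mulVec, Matrix.mul_nonsing_inv _ (isUnit_iff_ne_zero.2 hdet),
        Matrix.one_mulVec]
    have : D.mulVec (fun c => ∑ j, if f j = c then v j else 0) = (D.submatrix id f).mulVec v := by
      ext i
      simp only [Matrix.mulVec, dotProduct, mul_sum, Matrix.submatrix_apply, id]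
      rw [sum_comm]
      simp
    rw [Matrix.mulVec_add, this, hv, add_sub_cancel]
  · intro c hc
    have : ∑ j, (if f j = c then v j else 0) = 0 :=
      sum_eq_zero fun j _ => if_neg fun h : f j = c => hfS j (h ▸ hc)
    simp [this]

namespace TwoLayerNetwork

variable {m : ℕ}

/-! ### Linear codes in which the relays forward their symbols -/

section LinearCode

/-- The block of `w` that belongs to the message `i`, as a homomorphism. -/
def block (F : Type) [Field F] (r : Fin m → ℕ) (i : Fin m) :
    ((Σ i, Fin (r i)) → F) →+ (Fin (r i) → F) :=
  (LinearMap.funLeft F F fun j => (⟨i, j⟩ : Σ i, Fin (r i))).toAddMonoidHom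

@[simp]
lemma block_apply {F : Type} [Field F] {r : Fin m → ℕ} (i : Fin m) (w : (Σ i, Fin (r i)) → F)
    (j : Fin (r i)) :
    block F r i w j = w ⟨i, j⟩ := rfl

variable {F : Type} [Field F] [Fintype F] [MeasurableSpace F] [DiscreteMeasurableSpace F]
  {n : ℕ} {r : Fin m → ℕ}

/-- The code attached to a surjective linear map `D` with a linear section `s`: the symbols on the
first layer form a uniformly distributed vector `x`, the messages are the blocks of `D x`, the
randomness of the source is `x - s (D x)`, uniformly distributed on the kernel of `D`, and the
relays forward what they receive. -/
noncomputable def linearCode (N : TwoLayerNetwork m)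
    (D : (Fin N.t × Fin n → F) →ₗ[F] ((Σ i, Fin (r i)) → F))
    (s : ((Σ i, Fin (r i)) → F) →ₗ[F] (Fin N.t × Fin n → F)) (hs : D ∘ₗ s = LinearMap.id) :
    N.Code F n where
  Ω := Fin N.t × Fin n → F
  μ := uniformOn Set.univ
  c i := Fintype.card (Fin (r i) → F)
  W i x := Fintype.equivFin _ (block F r i (D x))
  measurable_W _ := Measurable.of_discrete
  Rand := LinearMap.ker D
  Θ x := ⟨x - s (D x), by
    have : D (s (D x)) = D x := LinearMap.congr_fun hs (D x)
    rw [LinearMap.mem_ker, map_sub, this, sub_self]⟩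
  measurable_Θ := Measurable.of_discrete
  indep_W := by
    refine (iIndepFun_uniformOn_univ (fun i => (block F r i).comp D.toAddMonoidHom)
      fun a => ⟨s fun q => a q.1 q.2, fun i => ?_⟩).comp
      (fun i => Fintype.equivFin (Fin (r i) → F)) fun i => Measurable.of_discrete
    have : D (s fun q => a q.1 q.2) = fun q => a q.1 q.2 := LinearMap.congr_fun hs _
    ext j
    simp [this]
  indep_Θ := by
    have : Fintype (LinearMap.ker D) := Fintype.ofFinite _
    have hDs : ∀ w, D (s w) = w := LinearMap.congr_fun hs
    let g : (Fin N.t × Fin n → F) →+ LinearMap.ker D :=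
      ((LinearMap.id - s ∘ₗ D).codRestrict (LinearMap.ker D) fun x => by
        simp [hDs]).toAddMonoidHom
    refine (indepFun_uniformOn_univ D.toAddMonoidHom g fun w θ => ⟨s w + θ, ?_, ?_⟩).comp
      (φ := fun w i => Fintype.equivFin _ (block F r i w)) (ψ := id)
      Measurable.of_discrete measurable_id
    · have : D θ = 0 := θ.2
      simp [hDs, this]
    · have : D θ = 0 := θ.2
      ext1
      simp [g, hDs, this]
  fSource e q := match e with
    | Sum.inl l => fun j =>
        (s (fun a => (Fintype.equivFin _).symm (q.1 a.1) a.2) + (q.2 : Fin N.t × Fin n → F)) (l, j)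
    | Sum.inr _ => 0
  measurable_fSource _ := Measurable.of_discrete
  fInner e := match e with
    | Sum.inl _ => 0
    | Sum.inr p => fun y => y ⟨Sum.inl p.1.2, rfl⟩
  X e x := match e with
    | Sum.inl l => fun j => x (l, j)
    | Sum.inr p => fun j => x (p.1.2, j)
  X_source e he x := by
    rcases e with l | p
    · have : (fun a : Σ i, Fin (r i) => block F r a.1 (D x) a.2) = D x := rfl
      simp [this, -block_apply]
    · simp [tail] at he
  X_inner e he x := by
    rcases e with l | p
    · simp [tail] at he
    · rfl

variable {N : TwoLayerNetwork m} {D : (Fin N.t × Fin n → F) →ₗ[F] ((Σ i, Fin (r i)) → F)}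
  {s : ((Σ i, Fin (r i)) → F) →ₗ[F] (Fin N.t × Fin n → F)} {hs : D ∘ₗ s = LinearMap.id}

lemma linearCode_rate (i : Fin m) : (N.linearCode D s hs).rate i = r i / n := by
  have hsurj : Function.Surjective ((block F r i).comp D.toAddMonoidHom) := fun a => by
    refine ⟨s fun q => if h : q.1 = i then a (h ▸ q.2) else 0, ?_⟩
    ext j
    have := LinearMap.congr_fun hs fun q => if h : q.1 = i then a (h ▸ q.2) else 0
    simp only [LinearMap.comp_apply, LinearMap.id_apply] at this
    simp [this]
  have hlog : Real.log (Fintype.card F) ≠ 0 :=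
    (Real.log_pos (by exact_mod_cast Fintype.one_lt_card)).ne'
  have h := entropy_uniformOn_univ (Fintype.card F) hsurj (Fintype.equivFin (Fin (r i) → F))
  refine congr_arg (· / (n : ℝ)) (h.trans ?_)
  rw [Fintype.card_fun, Fintype.card_fin, Nat.cast_pow, Real.log_pow, mul_div_cancel_right₀ _ hlog]

/-- The code is reliable if the block `i` of `D x` depends only on the symbols of the relays joined
to the destination `i`. -/
lemma linearCode_isReliable [DecidableEq F]
    (hD : ∀ i x x', (∀ l ∈ N.conn i, ∀ j, x (l, j) = x' (l, j)) → ∀ j, D x ⟨i, j⟩ = D x' ⟨i, j⟩) :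
    (N.linearCode D s hs).IsReliable := by
  intro i
  have hm : Measurable fun (x : Fin N.t × Fin n → F) (l : N.In (Node.dest i)) =>
      (N.linearCode D s hs).X l.1 x := Measurable.of_discrete
  let g : (N.In (Node.dest i) → Fin n → F) → Fin (Fintype.card (Fin (r i) → F)) :=
    fun y => Fintype.equivFin _ (block F r i (D fun q =>
      if h : q.1 ∈ N.conn i then y ⟨Sum.inr ⟨(i, q.1), h⟩, rfl⟩ q.2 else 0))
  have hW : (fun x => g fun l => (N.linearCode D s hs).X l.1 x) = (N.linearCode D s hs).W i := by
    funext x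
    refine congr_arg _ (funext fun j => hD i _ _ ?_ j)
    intro l hl j
    simp only [hl, dite_true]
    rfl
  have h := condEntropy_comp_self (b := Fintype.card F)
    (μ := uniformOn (Set.univ : Set (Fin N.t × Fin n → F))) hm g
  rw [← hW]
  exact h

/-- The code is secure if `D x` remains arbitrary when the symbols on `k` relays are given. -/
lemma linearCode_isSecure {k : ℕ}
    (hD : ∀ S : Finset (Fin N.t), S.card ≤ k → ∀ w (y : Fin N.t × Fin n → F), ∃ x, D x = w ∧
      ∀ l ∈ S, ∀ j, x (l, j) = y (l, j)) :
    (N.linearCode D s hs).IsSecure k := by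
  classical
  intro Z hZ
  have : DiscreteMeasurableSpace (N.linearCode D s hs).Ω :=
    inferInstanceAs (DiscreteMeasurableSpace (Fin N.t × Fin n → F))
  refine (mutualInfo_eq_zero_iff Measurable.of_discrete Measurable.of_discrete).2 ?_
  -- an edge carries no more than the symbols of the relay that it touches
  let relayOf : N.Edge → Fin N.t := Sum.elim id fun p => p.1.2
  let S := Z.image relayOf
  let g : (Fin N.t × Fin n → F) →+ (S × Fin n → F) :=
    (LinearMap.funLeft F F fun q : S × Fin n => ((q.1 : Fin N.t), q.2)).toAddMonoidHom
  have hX : ∀ e x, (N.linearCode D s hs).X e x = fun j => x (relayOf e, j) := by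
    rintro (l | p) x <;> rfl
  have hind := indepFun_uniformOn_univ D.toAddMonoidHom g fun w y => by
    obtain ⟨x, hx, hxy⟩ := hD S (card_image_le.trans hZ) w
      fun q => if h : q.1 ∈ S then y (⟨q.1, h⟩, q.2) else 0
    refine ⟨x, hx, funext fun q => ?_⟩
    have := hxy q.1 q.1.2 q.2
    simpa [g, LinearMap.funLeft] using this
  have := hind.comp (φ := fun w i => Fintype.equivFin _ (block F r i w))
    (ψ := fun y (e : {e // e ∈ Z}) j => y (⟨relayOf e.1, mem_image_of_mem _ e.2⟩, j))
    Measurable.of_discrete Measurable.of_discrete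
  have hXZ : (fun x (e : {e // e ∈ Z}) => (N.linearCode D s hs).X e.1 x) =
      fun x e j => x (relayOf e.1, j) := funext fun x => funext fun e => hX e.1 x
  rw [hXZ]
  exact this

end LinearCode

/-! ### The inner bound and the capacity region -/

/-- Hall's condition for the rows of the decoding matrix: after the deletion of at most `k` relays,
the symbols needed by the destinations can be matched to distinct symbols on relays that serve
them. -/
lemma exists_matching (N : TwoLayerNetwork m) {k n : ℕ} {r : Fin m → ℕ}
    (hr : ∀ A : Finset (Fin m), A.Nonempty → ∑ i ∈ A, r i + n * k ≤ n * (N.neighbors A).card)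
    {S : Finset (Fin N.t)} (hS : S.card ≤ k) :
    ∃ f : (Σ i, Fin (r i)) → Fin N.t × Fin n, Function.Injective f ∧
      ∀ q, f q ∈ (N.conn q.1 ×ˢ univ) \ (S ×ˢ univ) := by
  classical
  refine (all_card_le_biUnion_card_iff_exists_injective _).1 fun I => ?_
  rcases I.eq_empty_or_nonempty with rfl | hI
  · simp
  set A := I.image Sigma.fst with hA
  have h1 : I.card ≤ ∑ i ∈ A, r i := by
    calc I.card ≤ (A.sigma fun i => (univ : Finset (Fin (r i)))).card :=
          card_le_card fun q hq => mem_sigma.2 ⟨mem_image_of_mem _ hq, mem_univ _⟩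
      _ = ∑ i ∈ A, r i := by simp
  have h2 : (N.neighbors A \ S) ×ˢ (univ : Finset (Fin n)) ⊆
      I.biUnion fun q => (N.conn q.1 ×ˢ univ) \ (S ×ˢ univ) := by
    rintro ⟨l, j⟩ hl
    obtain ⟨hlA, hlS⟩ := mem_sdiff.1 (mem_product.1 hl).1
    obtain ⟨i, hi, hli⟩ := mem_biUnion.1 hlA
    obtain ⟨q, hq, rfl⟩ := mem_image.1 hi
    exact mem_biUnion.2 ⟨q, hq, by simp [hli, hlS]⟩
  have h3 := card_le_card h2
  rw [card_product, card_univ, Fintype.card_fin] at h3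
  have h4 := le_card_sdiff S (N.neighbors A)
  have h5 := hr A (hI.image _)
  calc I.card ≤ n * ((N.neighbors A).card - k) := by
        rw [Nat.mul_sub]
        omega
    _ ≤ n * (N.neighbors A \ S).card := Nat.mul_le_mul_left _ (by omega)
    _ ≤ _ := by rwa [mul_comm]

lemma securelyAchievable_of_sum_le (N : TwoLayerNetwork m) {k n : ℕ} (hn : 0 < n) {r : Fin m → ℕ}
    (hr : ∀ A : Finset (Fin m), A.Nonempty → ∑ i ∈ A, r i + n * k ≤ n * (N.neighbors A).card) :
    N.SecurelyAchievable k fun i => (r i : ℝ) / n := by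
  classical
  obtain ⟨p, hp, M, hM0, hM⟩ := exists_matrix_det_ne_zero
    (fun q : Σ i, Fin (r i) => N.conn q.1 ×ˢ (univ : Finset (Fin n)))
    (fun S : {S : Finset (Fin N.t) // S.card ≤ k} => S.1 ×ˢ univ)
    fun S => N.exists_matching hr S.2
  have hsec : ∀ S : Finset (Fin N.t), S.card ≤ k → ∀ w (y : Fin N.t × Fin n → ZMod p),
      ∃ x, M.mulVecLin x = w ∧ ∀ l ∈ S, ∀ j, x (l, j) = y (l, j) := by
    intro S hS w y
    obtain ⟨f, hf, hdet⟩ := hM ⟨S, hS⟩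
    obtain ⟨x, hx, hxy⟩ := exists_mulVec_eq_of_det_ne_zero M _ hf hdet w y
    exact ⟨x, hx, fun l hl j => hxy (l, j) (by simp [hl])⟩
  have hsurj : LinearMap.range M.mulVecLin = ⊤ := LinearMap.range_eq_top.2 fun w =>
    (hsec ∅ (by simp) w 0).imp fun _ h => h.1
  obtain ⟨s, hs⟩ := LinearMap.exists_rightInverse_of_surjective _ hsurj
  let _ : MeasurableSpace (ZMod p) := ⊤
  have : DiscreteMeasurableSpace (ZMod p) := ⟨fun _ => trivial⟩
  refine ⟨ZMod p, inferInstance, inferInstance, inferInstance, inferInstance, inferInstance, n, hn,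
    N.linearCode M.mulVecLin s hs, linearCode_isReliable ?_, linearCode_isSecure hsec,
    fun i => (linearCode_rate i).symm⟩
  intro i x x' hxx j
  simp only [Matrix.mulVecLin_apply, Matrix.mulVec, dotProduct]
  refine sum_congr rfl fun c _ => ?_
  by_cases hc : c.1 ∈ N.conn i
  · rw [hxx c.1 hc c.2]
  · rw [hM0 ⟨i, j⟩ c (by simp [hc]), zero_mul, zero_mul]

lemma SecurelyAchievable.nonneg {N : TwoLayerNetwork m} {k : ℕ} {R : Fin m → ℝ}
    (h : N.SecurelyAchievable k R) (i : Fin m) : 0 ≤ R i := by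
  obtain ⟨F, _, _, _, _, _, n, hn, C, -, -, hR⟩ := h
  rw [hR]
  exact div_nonneg (entropy_nonneg (by exact_mod_cast Fintype.card_pos) _) (Nat.cast_nonneg _)

lemma SecurelyAchievable.sum_le {N : TwoLayerNetwork m} {k : ℕ} {R : Fin m → ℝ}
    (h : N.SecurelyAchievable k R) {A : Finset (Fin m)} (hk : k ≤ N.minCut A) :
    ∑ i ∈ A, R i ≤ (N.minCut A : ℝ) - k := by
  obtain ⟨F, _, _, _, _, _, n, hn, C, hrel, hsec, hR⟩ := h
  rw [sum_congr rfl fun i _ => hR i]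
  exact C.sum_rate_le Fintype.one_lt_card hn hrel hsec A hk

/-- The rates rounded down to multiples of `1 / n` are achievable with block length `n`, and tend
to the given rates. -/
lemma mem_secureCapacityRegion_of_sum_le (N : TwoLayerNetwork m) {k : ℕ} {R : Fin m → ℝ}
    (h0 : ∀ i, 0 ≤ R i)
    (h : ∀ A : Finset (Fin m), A.Nonempty → ∑ i ∈ A, R i ≤ (N.minCut A : ℝ) - k) :
    R ∈ N.secureCapacityRegion k := by
  have hlim : Filter.Tendsto (fun (n : ℕ) i => (⌊R i * n⌋₊ : ℝ) / n) Filter.atTop (nhds R) := by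
    rw [tendsto_pi_nhds]
    exact fun i => (tendsto_nat_floor_mul_div_atTop (h0 i)).comp tendsto_natCast_atTop_atTop
  refine mem_closure_of_tendsto hlim ?_
  filter_upwards [Filter.eventually_gt_atTop 0] with n hn
  refine N.securelyAchievable_of_sum_le hn fun A hA => ?_
  have h1 : (∑ i ∈ A, (⌊R i * n⌋₊ : ℝ)) ≤ (∑ i ∈ A, R i) * n := by
    rw [sum_mul]
    exact sum_le_sum fun i _ => Nat.floor_le (mul_nonneg (h0 i) (Nat.cast_nonneg _))
  have h2 := mul_le_mul_of_nonneg_right (h A hA) (Nat.cast_nonneg (α := ℝ) n)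
  rw [minCut_eq_card_neighbors] at h2
  have : (∑ i ∈ A, (⌊R i * n⌋₊ : ℝ)) + n * k ≤ n * (N.neighbors A).card := by linarith
  exact_mod_cast this

lemma secureCapacityRegion_eq (N : TwoLayerNetwork m) {k : ℕ} (hk : ∀ i, k ≤ N.minCut {i}) :
    N.secureCapacityRegion k = {R : Fin m → ℝ | (∀ i, 0 ≤ R i) ∧
      ∀ A : Finset (Fin m), A.Nonempty → ∑ i ∈ A, R i ≤ (N.minCut A : ℝ) - k} := by
  refine Set.Subset.antisymm (closure_minimal ?_ ?_) fun R hR =>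
    N.mem_secureCapacityRegion_of_sum_le hR.1 hR.2
  · refine fun R hR => ⟨hR.nonneg, fun A ⟨i, hi⟩ => hR.sum_le ((hk i).trans ?_)⟩
    rw [minCut_eq_card_neighbors, minCut_eq_card_neighbors]
    exact card_le_card (N.neighbors_mono (singleton_subset_iff.2 hi))
  · have : {R : Fin m → ℝ | (∀ i, 0 ≤ R i) ∧
        ∀ A : Finset (Fin m), A.Nonempty → ∑ i ∈ A, R i ≤ (N.minCut A : ℝ) - k} =
        {R | 0 ≤ R} ∩ ⋂ A : Finset (Fin m), ⋂ _ : A.Nonempty,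
          {R | ∑ i ∈ A, R i ≤ (N.minCut A : ℝ) - k} := by
      ext R
      simp [Pi.le_def]
    rw [this]
    exact (isClosed_le continuous_const continuous_id).inter
      (isClosed_iInter fun A => isClosed_iInter fun _ => isClosed_le (by fun_prop) continuous_const)

end TwoLayerNetwork

theorem theorem2 (N : TwoLayerNetwork 3) (k : ℕ) (hk : ∀ i : Fin 3, k ≤ N.minCut {i}) :
    N.secureCapacityRegion k =
      {R : Fin 3 → ℝ | (∀ i, 0 ≤ R i) ∧
        ∀ A : Finset (Fin 3), A.Nonempty → ∑ i ∈ A, R i ≤ (N.minCut A : ℝ) - (k : ℝ)} :=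
  N.secureCapacityRegion_eq hk
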